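/- **Persistence of pointwise bounds.** Let $\mathbb T_L^d$ be the $d$-dimensional torus of side length $L>0$, let $W\in C^2(\mathbb T_L^d)$ be an interaction kernel, and for a density $N$ put $$w_N(x)=\int_{\mathbb T_L^d}W(x-y)N(y)\,dy ,\qquad w=\int_{\mathbb T_L^d}W(x)\,dx .$$ For a chemical potential $\mu\in\mathbb R$ let $m_0$ be the density of the uniform stationary state, i.e. $m_0=e^{\mu}e^{-w m_0}$. Consider the grand canonical McKean–Vlasov equation $$\frac{\partial N}{\partial t}-\nabla^2N-\nabla\cdot(N\nabla w_N)=-N e^{-\frac12(\mu-w_N)}+e^{\frac12(\mu-w_N)}\qquad\text{on }\mathbb T_L^d. \tag{1}$$ A classical solution on $[0,T)$, $T\le\infty$, is a function $N_t(x)$ that is jointly continuous on $[0,T)\times\mathbb T_L^d$ and that, at every time $t\in(0,T)$, is $C^2$ in $x$, differentiable in $t$, and satisfies (1) pointwise. Let $0<\kappa<\frac12$ and $A\in\mathbb R$. Then there is $\delta>0$, depending only on $\kappa$ and $A$, such that the following holds for all $d$, $L>0$ and all $W\in C^2(\mathbb T_L^d)$ with $\int_{\mathbb T_L^d}|W|\,dx\le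 A$ and $\int_{\mathbb T_L^d}|\nabla^2W|\,dx\le A$ (where $\nabla^2$ is the Laplacian). Let $\mu$ and $m_0$ be as above with $m_0<\delta$, let $N$ be a classical solution of (1) on $[0,T)$, and suppose that at some time $t_0\in[0,T)$ $$\kappa m_0<N_{t_0}(x)<\frac1\kappa m_0\qquad\text{for all }x\in\mathbb T_L^d .$$ Then $\kappa m_0<N_t(x)<\frac1\kappa m_0$ for all $x\in\mathbb T_L^d$ and all $t\in(t_0,T)$; in particular, for all $t>t_0$ if $T=\infty$. -/

import Mathlib

open MeasureTheory

/-- Functions on the `d`-dimensional torus of side length `L` are represented by functions on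
`ℝ^d` that are `L`-periodic in every coordinate direction. -/
def IsTorusPeriodic {d : ℕ} (L : ℝ) (f : EuclideanSpace ℝ (Fin d) → ℝ) : Prop :=
  ∀ (x : EuclideanSpace ℝ (Fin d)) (i : Fin d), f (x + EuclideanSpace.single i L) = f x

/-- The fundamental cell `[0, L)^d` of the torus. An integral over the torus is the Lebesgue
integral over this cell. -/
def torusCell (d : ℕ) (L : ℝ) : Set (EuclideanSpace ℝ (Fin d)) :=
  {x | ∀ i, x i ∈ Set.Ico 0 L}

/-- The potential `w_N(x) = ∫ W(x - y) N(y) dy` (integral over the torus) generated by the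
density `N` through the interaction `W`. -/
noncomputable def interactionPotential {d : ℕ} (L : ℝ) (W N : EuclideanSpace ℝ (Fin d) → ℝ)
    (x : EuclideanSpace ℝ (Fin d)) : ℝ :=
  ∫ y in torusCell d L, W (x - y) * N y

/-- The divergence `∑ i, ∂ᵢ Fᵢ` of a vector field on `ℝ^d`. -/
noncomputable def vectorDivergence {d : ℕ}
    (F : EuclideanSpace ℝ (Fin d) → EuclideanSpace ℝ (Fin d))
    (x : EuclideanSpace ℝ (Fin d)) : ℝ :=
  ∑ i, (fderiv ℝ F x (EuclideanSpace.single i 1)) i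

/-- The value at `x` of
`∇²N + ∇ · (N ∇w_N) - N exp(-(μ - w_N)/2) + exp((μ - w_N)/2)`. -/
noncomputable def grandCanonicalRHS {d : ℕ} (L : ℝ) (W : EuclideanSpace ℝ (Fin d) → ℝ) (μ : ℝ)
    (N : EuclideanSpace ℝ (Fin d) → ℝ) (x : EuclideanSpace ℝ (Fin d)) : ℝ :=
  Laplacian.laplacian N x
    + vectorDivergence (fun y => N y • gradient (interactionPotential L W N) y) x
    - N x * Real.exp (-(1 / 2) * (μ - interactionPotential L W N x))
    + Real.exp ((1 / 2) * (μ - interactionPotential L W N x))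

/-- Classical solutions, on the time interval `[0, T)` with `T ≤ ∞`, of the grand canonical
McKean–Vlasov equation
`∂N/∂t - ∇²N - ∇ · (N ∇w_N) = - N exp(-(μ - w_N)/2) + exp((μ - w_N)/2)` on the torus:
`N` is continuous up to the initial time, and at positive times it is `C²` in space,
differentiable in time and satisfies the equation pointwise. -/
structure IsGrandCanonicalSolution {d : ℕ} (L : ℝ) (W : EuclideanSpace ℝ (Fin d) → ℝ) (μ : ℝ)
    (T : EReal) (N : ℝ → EuclideanSpace ℝ (Fin d) → ℝ) : Prop where
  periodic : ∀ t : ℝ, 0 ≤ t → (t : EReal) < T → IsTorusPeriodic L (N t)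
  continuousOn : ContinuousOn (fun p : ℝ × EuclideanSpace ℝ (Fin d) => N p.1 p.2)
    ({t : ℝ | 0 ≤ t ∧ (t : EReal) < T} ×ˢ Set.univ)
  contDiff : ∀ t : ℝ, 0 < t → (t : EReal) < T → ContDiff ℝ 2 (N t)
  equation : ∀ t : ℝ, 0 < t → (t : EReal) < T → ∀ x : EuclideanSpace ℝ (Fin d),
    HasDerivAt (fun s => N s x) (grandCanonicalRHS L W μ (N t) x) t

/-- `m₀` is the density of the uniform stationary state at chemical potential `μ`:
`m₀ = e^μ e^{-w m₀}` with `w = ∫ W` (integral over the torus). -/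
def IsUniformDensity {d : ℕ} (L : ℝ) (W : EuclideanSpace ℝ (Fin d) → ℝ) (μ m₀ : ℝ) : Prop :=
  m₀ = Real.exp μ * Real.exp (-((∫ x in torusCell d L, W x) * m₀))

/-! The proof is a maximum principle at a first touching time (`exists_first_touching`). If a bound
fails, there is a first time at which `N` attains `κ * m₀` or `m₀ / κ`, at a global spatial
extremum. There the gradient of `N` vanishes, the Laplacian has a favourable sign, and the drift
reduces to `N` times the convolution of `N` with the Laplacian of `W`, which is of order `m₀ ^ 2`.
The definition of `m₀` turns the reaction at that point into `√m₀ * exp θ - (N / √m₀) * exp (-θ)`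
with `|θ| ≤ A * (m₀ + m₀ / κ) / 2`. For small `m₀` this is close to `√m₀ * (1 - κ)` at the lower
bound and to `√m₀ * (1 - 1 / κ)` at the upper one, so it dominates the drift
(`exists_reaction_dominates`). The time derivative then points strictly into the allowed interval,
which contradicts the bounds at earlier times. Since this sign is strict, no perturbation of `N` is
needed. -/

open MeasureTheory Filter Topology

/-! ### The torus cell and periodic functions -/

/-- The basis `L • eᵢ` of `ℝ^d`, which spans the lattice of periods of the torus. -/
noncomputable def torusBasis (d : ℕ) {L : ℝ} (hL : 0 < L) :
    Module.Basis (Fin d) ℝ (EuclideanSpace ℝ (Fin d)) :=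
  (EuclideanSpace.basisFun (Fin d) ℝ).toBasis.isUnitSMul (w := fun _ => L)
    (fun _ => hL.ne'.isUnit)

theorem torusBasis_apply {d : ℕ} {L : ℝ} (hL : 0 < L) (i : Fin d) :
    torusBasis d hL i = EuclideanSpace.single i L := by
  ext j
  simp [torusBasis, Module.Basis.isUnitSMul_apply]

theorem torusBasis_repr {d : ℕ} {L : ℝ} (hL : 0 < L) (x : EuclideanSpace ℝ (Fin d)) (i : Fin d) :
    (torusBasis d hL).repr x i = L⁻¹ * x i := by
  simp [torusBasis, Module.Basis.repr_isUnitSMul, Units.smul_def]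

theorem torusCell_eq_fundamentalDomain {d : ℕ} {L : ℝ} (hL : 0 < L) :
    torusCell d L = ZSpan.fundamentalDomain (torusBasis d hL) := by
  ext x
  simp only [torusCell, ZSpan.fundamentalDomain, Set.mem_ofPred_eq, torusBasis_repr, Set.mem_Ico]
  refine forall_congr' fun i => and_congr ?_ ?_
  · rw [mul_nonneg_iff_of_pos_left (inv_pos.2 hL)]
  · rw [inv_mul_lt_iff₀ hL, mul_one]

theorem measurableSet_torusCell {d : ℕ} {L : ℝ} (hL : 0 < L) : MeasurableSet (torusCell d L) := by
  rw [torusCell_eq_fundamentalDomain hL]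
  exact ZSpan.fundamentalDomain_measurableSet _

theorem isBounded_torusCell {d : ℕ} {L : ℝ} (hL : 0 < L) :
    Bornology.IsBounded (torusCell d L) := by
  rw [torusCell_eq_fundamentalDomain hL]
  exact ZSpan.fundamentalDomain_isBounded _

theorem exists_torusCell_subset_closedBall (d : ℕ) {L : ℝ} (hL : 0 < L) :
    ∃ R, torusCell d L ⊆ Metric.closedBall 0 R :=
  (isBounded_torusCell hL).subset_closedBall 0

theorem Continuous.integrableOn_torusCell {d : ℕ} {L : ℝ} (hL : 0 < L) {F : Type*}
    [NormedAddCommGroup F] {f : EuclideanSpace ℝ (Fin d) → F} (hf : Continuous f) :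
    IntegrableOn f (torusCell d L) := by
  obtain ⟨R, hR⟩ := exists_torusCell_subset_closedBall d hL
  exact (hf.continuousOn.integrableOn_compact (isCompact_closedBall 0 R)).mono_set hR

theorem IsTorusPeriodic.add_mem_span {d : ℕ} {L : ℝ} (hL : 0 < L)
    {f : EuclideanSpace ℝ (Fin d) → ℝ} (hf : IsTorusPeriodic L f) {v : EuclideanSpace ℝ (Fin d)}
    (hv : v ∈ Submodule.span ℤ (Set.range (torusBasis d hL))) (x : EuclideanSpace ℝ (Fin d)) :
    f (x + v) = f x := by
  induction hv using Submodule.span_induction generalizing x with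
  | mem v hv =>
    obtain ⟨i, rfl⟩ := hv
    rw [torusBasis_apply]
    exact hf x i
  | zero => simp
  | add v w _ _ hv hw => rw [← add_assoc, hw, hv]
  | smul n v _ hv =>
    induction n using Int.induction_on generalizing x with
    | zero => simp
    | succ n ih => rw [add_smul, one_smul, ← add_assoc, hv, ih]
    | pred n ih =>
      rw [← hv (x + _), add_assoc, sub_smul, one_smul, sub_add_cancel, ih]

/-- The representative does not depend on `f`. This lets violations of the bounds be moved into a
bounded set, where compactness is available. -/
theorem exists_mem_torusCell {d : ℕ} {L : ℝ} (hL : 0 < L) (x : EuclideanSpace ℝ (Fin d)) :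
    ∃ y ∈ torusCell d L, ∀ f : EuclideanSpace ℝ (Fin d) → ℝ, IsTorusPeriodic L f → f x = f y := by
  refine ⟨ZSpan.fract (torusBasis d hL) x, ?_, fun f hf => ?_⟩
  · rw [torusCell_eq_fundamentalDomain hL]
    exact ZSpan.fract_mem_fundamentalDomain _ x
  · have h := hf.add_mem_span hL (ZSpan.floor (torusBasis d hL) x).2
      (ZSpan.fract (torusBasis d hL) x)
    rw [ZSpan.fract_apply, sub_add_cancel] at h
    rw [ZSpan.fract_apply, h]

/-- Integrals over the torus are invariant under reflections. -/
theorem IsTorusPeriodic.integral_sub_left {d : ℕ} {L : ℝ} (hL : 0 < L)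
    {f : EuclideanSpace ℝ (Fin d) → ℝ} (hf : IsTorusPeriodic L f)
    (x : EuclideanSpace ℝ (Fin d)) :
    ∫ y in torusCell d L, f (x - y) = ∫ y in torusCell d L, f y := by
  set b := torusBasis d hL
  have hD : IsAddFundamentalDomain (Submodule.span ℤ (Set.range b)).toAddSubgroup
      (torusCell d L) volume := by
    rw [torusCell_eq_fundamentalDomain hL]
    exact ZSpan.isAddFundamentalDomain' b volume
  have hmp : MeasurePreserving (fun y : EuclideanSpace ℝ (Fin d) => x - y) volume volume :=
    Measure.measurePreserving_sub_left volume x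
  have hD' : IsAddFundamentalDomain (Submodule.span ℤ (Set.range b)).toAddSubgroup
      ((fun y => x - y) ⁻¹' torusCell d L) volume :=
    -- Reflection reverses lattice translations, hence the relabelling `g ↦ -g`.
    hD.preimage_of_equiv hmp.quasiMeasurePreserving (e := fun g => -g) neg_involutive.bijective
      fun g y => by
        simp only [AddSubgroup.vadd_def, vadd_eq_add, NegMemClass.coe_neg]
        abel
  have h1 : ∫ y in (fun y => x - y) ⁻¹' torusCell d L, f (x - y) = ∫ y in torusCell d L, f y :=
    hmp.setIntegral_preimage_emb (MeasurableEquiv.subLeft x).measurableEmbedding f _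
  rw [← h1]
  have : Countable (Submodule.span ℤ (Set.range b)).toAddSubgroup :=
    inferInstanceAs (Countable (Submodule.span ℤ (Set.range b)))
  refine hD.setIntegral_eq hD' fun g y => ?_
  have := hf.add_mem_span hL (neg_mem g.2) (x - y)
  rw [← this]
  congr 1
  simp only [AddSubgroup.vadd_def, vadd_eq_add]
  abel

theorem IsTorusPeriodic.laplacian {d : ℕ} {L : ℝ} {f : EuclideanSpace ℝ (Fin d) → ℝ}
    (hf : IsTorusPeriodic L f) : IsTorusPeriodic L (Laplacian.laplacian f) := by
  intro x i
  simp only [InnerProductSpace.laplacian_eq_iteratedFDeriv_orthonormalBasis f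
    (EuclideanSpace.basisFun (Fin d) ℝ)]
  rw [← iteratedFDeriv_comp_add_right]
  rw [show (fun y => f (y + EuclideanSpace.single i L)) = f from funext fun y => hf y i]

theorem laplacian_eq_sum_fderiv {d : ℕ} (f : EuclideanSpace ℝ (Fin d) → ℝ)
    (x : EuclideanSpace ℝ (Fin d)) :
    Laplacian.laplacian f x = ∑ i, fderiv ℝ (fderiv ℝ f) x (EuclideanSpace.single i 1)
      (EuclideanSpace.single i 1) := by
  simp [InnerProductSpace.laplacian_eq_iteratedFDeriv_orthonormalBasis f
    (EuclideanSpace.basisFun (Fin d) ℝ), iteratedFDeriv_two_apply]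

theorem ContDiff.continuous_laplacian {d : ℕ} {f : EuclideanSpace ℝ (Fin d) → ℝ}
    (hf : ContDiff ℝ 2 f) : Continuous (Laplacian.laplacian f) := by
  have h : Continuous (fderiv ℝ (fderiv ℝ f)) :=
    (hf.fderiv_right (m := 1) (by norm_num)).continuous_fderiv (by norm_num)
  have he : Laplacian.laplacian f = fun x => ∑ i,
      fderiv ℝ (fderiv ℝ f) x (EuclideanSpace.single i 1) (EuclideanSpace.single i 1) :=
    funext (laplacian_eq_sum_fderiv f)
  rw [he]
  fun_prop

/-! ### Convolution with the interaction kernel -/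

/-- A bound for the convolution of a density with a periodic kernel on the torus. -/
theorem abs_interactionPotential_le {d : ℕ} {L : ℝ} (hL : 0 < L)
    {W N : EuclideanSpace ℝ (Fin d) → ℝ} (hW : IsTorusPeriodic L W) (hWc : Continuous W)
    {C A : ℝ} (hC : 0 ≤ C) (hN : ∀ y, |N y| ≤ C) (hA : ∫ y in torusCell d L, |W y| ≤ A)
    (x : EuclideanSpace ℝ (Fin d)) : |interactionPotential L W N x| ≤ A * C := by
  have hp : IsTorusPeriodic L fun y => |W y| := fun y i => congrArg _ (hW y i)
  calc |interactionPotential L W N x| ≤ ∫ y in torusCell d L, |W (x - y)| * C := by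
        refine norm_integral_le_of_norm_le (f := fun y => W (x - y) * N y) ?_ (ae_of_all _ fun y => ?_)
        · exact Continuous.integrableOn_torusCell hL (by fun_prop)
        · rw [norm_mul, Real.norm_eq_abs, Real.norm_eq_abs]
          exact mul_le_mul_of_nonneg_left (hN y) (abs_nonneg _)
    _ = (∫ y in torusCell d L, |W y|) * C := by
        rw [integral_mul_const, hp.integral_sub_left hL]
    _ ≤ A * C := mul_le_mul_of_nonneg_right hA hC

/-- Differentiation of a convolution over the cell. -/
theorem hasFDerivAt_integral_torusCell {d : ℕ} {L : ℝ} (hL : 0 < L) {F : Type*}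
    [NormedAddCommGroup F] [NormedSpace ℝ F]
    {N : EuclideanSpace ℝ (Fin d) → ℝ} (hN : Continuous N) {G : EuclideanSpace ℝ (Fin d) → F}
    (hG : ContDiff ℝ 1 G) (x : EuclideanSpace ℝ (Fin d)) :
    HasFDerivAt (fun x => ∫ y in torusCell d L, N y • G (x - y))
      (∫ y in torusCell d L, N y • fderiv ℝ G (x - y)) x := by
  have hG' : Continuous (fderiv ℝ G) := hG.continuous_fderiv (by norm_num)
  have hGc : Continuous G := hG.continuous
  obtain ⟨R, hR⟩ := exists_torusCell_subset_closedBall d hL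
  obtain ⟨B, hB⟩ := ((isCompact_closedBall x 1).prod (isCompact_closedBall 0 R)).exists_bound_of_continuousOn
    (f := fun p : EuclideanSpace ℝ (Fin d) × EuclideanSpace ℝ (Fin d) =>
      N p.2 • fderiv ℝ G (p.1 - p.2)) (by fun_prop)
  refine hasFDerivAt_integral_of_dominated_of_fderiv_le (s := Metric.closedBall x 1)
    (bound := fun _ => B) (F' := fun x y => N y • fderiv ℝ G (x - y))
    (Metric.closedBall_mem_nhds x one_pos) (Eventually.of_forall fun z => ?_) ?_ ?_ ?_ ?_ ?_
  · exact (Continuous.integrableOn_torusCell hL (by fun_prop)).aestronglyMeasurable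
  · exact Continuous.integrableOn_torusCell hL (by fun_prop)
  · exact (Continuous.integrableOn_torusCell hL (by fun_prop)).aestronglyMeasurable
  · filter_upwards [ae_restrict_mem (measurableSet_torusCell hL)] with y hy z hz
    exact hB (z, y) ⟨hz, hR hy⟩
  · exact Continuous.integrableOn_torusCell hL continuous_const
  · refine ae_of_all _ fun y z _ => ?_
    have h := (hG.differentiable (by norm_num) (z - y)).hasFDerivAt
    have h' : HasFDerivAt (fun z => G (z - y)) (fderiv ℝ G (z - y)) z :=
      h.comp z ((hasFDerivAt_id z).sub_const y)
    exact h'.const_smul (N y)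

theorem integral_torusCell_smul_apply {d : ℕ} {L : ℝ} (hL : 0 < L) {F : Type*}
    [NormedAddCommGroup F] [NormedSpace ℝ F] {N : EuclideanSpace ℝ (Fin d) → ℝ}
    (hN : Continuous N) {G : EuclideanSpace ℝ (Fin d) → EuclideanSpace ℝ (Fin d) →L[ℝ] F}
    (hG : Continuous G) (x v : EuclideanSpace ℝ (Fin d)) :
    (∫ y in torusCell d L, N y • G (x - y)) v = ∫ y in torusCell d L, N y • G (x - y) v := by
  have h : IntegrableOn (fun y => N y • G (x - y)) (torusCell d L) :=
    Continuous.integrableOn_torusCell hL (by fun_prop)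
  exact ContinuousLinearMap.integral_apply h v

section Potential

variable {d : ℕ} {L : ℝ} {W N : EuclideanSpace ℝ (Fin d) → ℝ}

theorem interactionPotential_eq_integral_smul (L : ℝ) (W N : EuclideanSpace ℝ (Fin d) → ℝ) :
    interactionPotential L W N = fun x => ∫ y in torusCell d L, N y • W (x - y) := by
  ext x
  simp only [interactionPotential, smul_eq_mul, mul_comm]

theorem fderiv_interactionPotential (hL : 0 < L) (hW : ContDiff ℝ 2 W) (hN : Continuous N) :
    fderiv ℝ (interactionPotential L W N) =
      fun x => ∫ y in torusCell d L, N y • fderiv ℝ W (x - y) := by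
  ext1 x
  rw [interactionPotential_eq_integral_smul]
  exact (hasFDerivAt_integral_torusCell hL hN (hW.of_le (by norm_num)) x).fderiv

theorem hasFDerivAt_fderiv_interactionPotential (hL : 0 < L) (hW : ContDiff ℝ 2 W)
    (hN : Continuous N) (x : EuclideanSpace ℝ (Fin d)) :
    HasFDerivAt (fderiv ℝ (interactionPotential L W N))
      (∫ y in torusCell d L, N y • fderiv ℝ (fderiv ℝ W) (x - y)) x := by
  rw [fderiv_interactionPotential hL hW hN]
  exact hasFDerivAt_integral_torusCell hL hN (hW.fderiv_right (by norm_num)) x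

/-- All derivatives fall on `W`, so continuity of `N` suffices and the `L¹` bound on the Laplacian
of `W` controls the result. -/
theorem laplacian_interactionPotential (hL : 0 < L) (hW : ContDiff ℝ 2 W) (hN : Continuous N)
    (x : EuclideanSpace ℝ (Fin d)) :
    Laplacian.laplacian (interactionPotential L W N) x =
      interactionPotential L (Laplacian.laplacian W) N x := by
  have hc : Continuous (fderiv ℝ (fderiv ℝ W)) :=
    (hW.fderiv_right (m := 1) (by norm_num)).continuous_fderiv (by norm_num)
  rw [laplacian_eq_sum_fderiv, (hasFDerivAt_fderiv_interactionPotential hL hW hN x).fderiv,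
    interactionPotential_eq_integral_smul]
  simp only [laplacian_eq_sum_fderiv, Finset.smul_sum]
  rw [integral_finsetSum _ fun i _ => Continuous.integrableOn_torusCell hL (by fun_prop)]
  refine Finset.sum_congr rfl fun i _ => ?_
  rw [integral_torusCell_smul_apply hL hN hc, integral_torusCell_smul_apply hL hN (by fun_prop)
    (G := fun z => fderiv ℝ (fderiv ℝ W) z (EuclideanSpace.single i 1))]

/-- At a critical point of `N` the drift term `∇ · (N ∇w_N)` reduces to `N ∇²w_N`. -/
theorem vectorDivergence_smul_gradient_interactionPotential (hL : 0 < L) (hW : ContDiff ℝ 2 W)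
    (hN : ContDiff ℝ 2 N) {x : EuclideanSpace ℝ (Fin d)} (hx : fderiv ℝ N x = 0) :
    vectorDivergence (fun y => N y • gradient (interactionPotential L W N) y) x =
      N x * interactionPotential L (Laplacian.laplacian W) N x := by
  have h2 := hasFDerivAt_fderiv_interactionPotential hL hW hN.continuous x
  have hg : HasFDerivAt (gradient (interactionPotential L W N))
      ((InnerProductSpace.toDual ℝ (EuclideanSpace ℝ (Fin d))).symm.toContinuousLinearEquiv.toContinuousLinearMap ∘L
        fderiv ℝ (fderiv ℝ (interactionPotential L W N)) x) x := by
    rw [h2.fderiv]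
    exact (InnerProductSpace.toDual ℝ
      (EuclideanSpace ℝ (Fin d))).symm.toContinuousLinearEquiv.hasFDerivAt.comp x h2
  have hNx := (hN.differentiable (by norm_num) x).hasFDerivAt
  rw [← laplacian_interactionPotential hL hW hN.continuous, laplacian_eq_sum_fderiv,
    vectorDivergence, Finset.mul_sum]
  refine Finset.sum_congr rfl fun i _ => ?_
  rw [show fderiv ℝ (fun y => N y • gradient (interactionPotential L W N) y) x = _ from
    (hNx.smul hg).fderiv, hx]
  set T := fderiv ℝ (fderiv ℝ (interactionPotential L W N)) x (EuclideanSpace.single i 1) with hT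
  -- Coordinates of the Riesz representative are the values of the functional on the standard basis.
  have key : ((InnerProductSpace.toDual ℝ (EuclideanSpace ℝ (Fin d))).symm T) i =
      T (EuclideanSpace.single i 1) := by
    rw [← InnerProductSpace.toDual_symm_apply (x := EuclideanSpace.single i (1 : ℝ)) (y := T),
      EuclideanSpace.inner_single_right]
    simp
  simp [← hT, key]

end Potential

/-! ### Derivative tests in space and time -/

/-- The second derivative is nonnegative at a local minimum. -/
theorem IsLocalMin.deriv_deriv_nonneg {f : ℝ → ℝ} {a : ℝ} (h : IsLocalMin f a)
    (hc : ContinuousAt f a) : 0 ≤ deriv (deriv f) a := by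
  by_contra! hlt
  -- A negative second derivative would also make `a` a local maximum, so `f` would be locally
  -- constant with zero second derivative.
  have hmax := isLocalMax_of_deriv_deriv_neg hlt h.deriv_eq_zero hc
  have hconst : f =ᶠ[𝓝 a] fun _ => f a := by
    filter_upwards [h, hmax] with x h1 h2 using le_antisymm h2 h1
  have h0 := hconst.deriv.deriv_eq
  simp at h0
  exact hlt.ne h0

theorem IsLocalMin.laplacian_nonneg {d : ℕ} {f : EuclideanSpace ℝ (Fin d) → ℝ}
    (hf : ContDiff ℝ 2 f) {x : EuclideanSpace ℝ (Fin d)} (h : IsLocalMin f x) :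
    0 ≤ Laplacian.laplacian f x := by
  rw [laplacian_eq_sum_fderiv]
  refine Finset.sum_nonneg fun i _ => ?_
  set v : EuclideanSpace ℝ (Fin d) := EuclideanSpace.single i 1
  have hline (s : ℝ) : HasDerivAt (fun s : ℝ => x + s • v) v s := by
    simpa using ((hasDerivAt_id s).smul_const v).const_add x
  have hd0 : Differentiable ℝ f := hf.differentiable (by norm_num)
  have h1 : deriv (fun s : ℝ => f (x + s • v)) = fun s => fderiv ℝ f (x + s • v) v :=
    funext fun s => ((hd0 (x + s • v)).hasFDerivAt.comp_hasDerivAt s (hline s)).deriv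
  have hd : Differentiable ℝ (fderiv ℝ f) :=
    (hf.fderiv_right (m := 1) (by norm_num)).differentiable (by norm_num)
  have h2 : deriv (deriv (fun s : ℝ => f (x + s • v))) 0 = fderiv ℝ (fderiv ℝ f) x v v := by
    rw [h1]
    have h3 : HasDerivAt (fun s : ℝ => fderiv ℝ f (x + s • v))
        (fderiv ℝ (fderiv ℝ f) (x + (0 : ℝ) • v) v) 0 :=
      (hd (x + (0 : ℝ) • v)).hasFDerivAt.comp_hasDerivAt 0 (hline 0)
    have h4 := (h3.clm_apply (hasDerivAt_const (0 : ℝ) v)).deriv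
    rwa [map_zero, add_zero, zero_smul, add_zero] at h4
  rw [← h2]
  have hcont : Continuous fun s : ℝ => x + s • v := by fun_prop
  refine IsLocalMin.deriv_deriv_nonneg ?_ (hf.continuous.comp hcont).continuousAt
  have ht : Tendsto (fun s : ℝ => x + s • v) (𝓝 0) (𝓝 x) := by
    simpa using hcont.tendsto 0
  simpa [IsLocalMin, IsMinFilter] using ht.eventually h

theorem IsLocalMax.laplacian_nonpos {d : ℕ} {f : EuclideanSpace ℝ (Fin d) → ℝ}
    (hf : ContDiff ℝ 2 f) {x : EuclideanSpace ℝ (Fin d)} (h : IsLocalMax f x) :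
    Laplacian.laplacian f x ≤ 0 := by
  have := IsLocalMin.laplacian_nonneg hf.neg h.neg
  have hn : Laplacian.laplacian (-f) x = -Laplacian.laplacian f x := by
    simp [InnerProductSpace.laplacian_neg]
  have h' : 0 ≤ Laplacian.laplacian (-f) x := this
  linarith

/-- Left difference quotients are eventually positive. The earlier time found here contradicts the
bounds before first touching. -/
theorem exists_lt_of_hasDerivAt_pos {f : ℝ → ℝ} {f' a b : ℝ} (hab : a < b)
    (h : HasDerivAt f f' b) (hf' : 0 < f') : ∃ s ∈ Set.Ioo a b, f s < f b := by
  have h1 := (hasDerivAt_iff_tendsto_slope.1 h).mono_left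
    (nhdsWithin_mono b fun s (hs : s ∈ Set.Iio b) => ne_of_lt hs)
  obtain ⟨s, hpos, hs⟩ :=
    ((h1.eventually (lt_mem_nhds hf')).and (Ioo_mem_nhdsLT hab)).exists
  refine ⟨s, hs, ?_⟩
  rw [slope_def_field] at hpos
  by_contra! hle
  exact absurd hpos (not_lt.2 (div_nonpos_of_nonneg_of_nonpos (by linarith) (by linarith [hs.2])))

/-! ### Reaction against drift -/

/-- For small densities the reaction term dominates the interaction at both bounds. -/
theorem exists_reaction_dominates {κ : ℝ} (hκ₀ : 0 < κ) (hκ₁ : κ < 1) (A : ℝ) :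
    ∃ δ : ℝ, 0 < δ ∧ ∀ m, 0 < m → m < δ →
      κ * Real.exp (A * (m + m / κ) / 2) + A * m * √m < Real.exp (-(A * (m + m / κ) / 2)) ∧
      Real.exp (A * (m + m / κ) / 2) + A / κ * m * √m / κ <
        1 / κ * Real.exp (-(A * (m + m / κ) / 2)) := by
  have h1 : ∀ᶠ m in 𝓝 (0 : ℝ),
      κ * Real.exp (A * (m + m / κ) / 2) + A * m * √m < Real.exp (-(A * (m + m / κ) / 2)) := by
    -- Both sides are continuous in `m`; at `m = 0` the inequality reads `κ < 1`.
    refine ContinuousAt.eventually_lt (by fun_prop) (by fun_prop) ?_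
    simpa using hκ₁
  have h2 : ∀ᶠ m in 𝓝 (0 : ℝ), Real.exp (A * (m + m / κ) / 2) + A / κ * m * √m / κ <
        1 / κ * Real.exp (-(A * (m + m / κ) / 2)) := by
    refine ContinuousAt.eventually_lt (by fun_prop) (by fun_prop) ?_
    simpa using (one_lt_inv₀ hκ₀).2 hκ₁
  obtain ⟨δ, hδ, h⟩ := Metric.eventually_nhds_iff.1 (h1.and h2)
  exact ⟨δ, hδ, fun m hm hmδ => h (by rwa [Real.dist_eq, sub_zero, abs_of_pos hm])⟩

section Estimates

variable {d : ℕ} {L : ℝ} {W N : EuclideanSpace ℝ (Fin d) → ℝ} {μ m A κ : ℝ}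

theorem IsUniformDensity.pos (h : IsUniformDensity L W μ m) : 0 < m := by
  rw [IsUniformDensity] at h
  rw [h]
  positivity

/-- The reaction rates, expressed through the uniform density. -/
theorem IsUniformDensity.exp_half (h : IsUniformDensity L W μ m) (v : ℝ) :
    Real.exp ((1 / 2) * (μ - v)) =
      √m * Real.exp (((∫ x in torusCell d L, W x) * m - v) / 2) := by
  have hm : m = Real.exp ((μ - (∫ x in torusCell d L, W x) * m) / 2) ^ 2 := by
    rw [← Real.exp_nat_mul]
    conv_lhs => rw [h, ← Real.exp_add]
    congr 1
    push_cast
    ring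
  have hs : √m = Real.exp ((μ - (∫ x in torusCell d L, W x) * m) / 2) := by
    conv_lhs => rw [hm]
    exact Real.sqrt_sq (Real.exp_nonneg _)
  rw [hs, ← Real.exp_add]
  congr 1
  ring

/-- The right-hand side of the equation at a critical point of the density. -/
theorem grandCanonicalRHS_of_fderiv_eq_zero (hL : 0 < L) (hW : ContDiff ℝ 2 W)
    (hm : IsUniformDensity L W μ m) (hN : ContDiff ℝ 2 N) {x : EuclideanSpace ℝ (Fin d)}
    (hx : fderiv ℝ N x = 0) :
    grandCanonicalRHS L W μ N x = Laplacian.laplacian N x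
      + N x * interactionPotential L (Laplacian.laplacian W) N x
      - N x / √m * Real.exp
          (-(((∫ x in torusCell d L, W x) * m - interactionPotential L W N x) / 2))
      + √m * Real.exp (((∫ x in torusCell d L, W x) * m - interactionPotential L W N x) / 2) := by
  rw [grandCanonicalRHS, vectorDivergence_smul_gradient_interactionPotential hL hW hN hx,
    neg_mul, Real.exp_neg, hm.exp_half, mul_inv, Real.exp_neg]
  ring

theorem abs_uniform_sub_potential_le (hL : 0 < L) (hWp : IsTorusPeriodic L W)
    (hW : Continuous W) (hA : ∫ x in torusCell d L, |W x| ≤ A) (hm : 0 < m) {C : ℝ}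
    (hC : 0 ≤ C) (hNC : ∀ y, |N y| ≤ C) (x : EuclideanSpace ℝ (Fin d)) :
    |((∫ x in torusCell d L, W x) * m - interactionPotential L W N x) / 2| ≤
      A * (m + C) / 2 := by
  have h1 := abs_interactionPotential_le hL hWp hW hC hNC hA x
  have h2 : |(∫ x in torusCell d L, W x) * m| ≤ A * m := by
    rw [abs_mul, abs_of_pos hm]
    exact mul_le_mul_of_nonneg_right (abs_integral_le_integral_abs.trans hA) hm.le
  rw [abs_div, abs_two]
  have := abs_sub ((∫ x in torusCell d L, W x) * m) (interactionPotential L W N x)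
  linarith

theorem grandCanonicalRHS_pos_of_min (hκ₀ : 0 < κ) (hL : 0 < L) (hWp : IsTorusPeriodic L W)
    (hW : ContDiff ℝ 2 W) (hA : ∫ x in torusCell d L, |W x| ≤ A)
    (hA' : ∫ x in torusCell d L, |Laplacian.laplacian W x| ≤ A)
    (hm : IsUniformDensity L W μ m)
    (hdom : κ * Real.exp (A * (m + m / κ) / 2) + A * m * √m <
      Real.exp (-(A * (m + m / κ) / 2)))
    (hN : ContDiff ℝ 2 N) (hNC : ∀ y, |N y| ≤ m / κ) {x : EuclideanSpace ℝ (Fin d)}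
    (hx : IsLocalMin N x) (hNx : N x = κ * m) : 0 < grandCanonicalRHS L W μ N x := by
  have hmp := hm.pos
  have hC : 0 ≤ m / κ := by positivity
  rw [grandCanonicalRHS_of_fderiv_eq_zero hL hW hm hN hx.fderiv_eq_zero]
  have hθ := abs_le.1 (abs_uniform_sub_potential_le hL hWp hW.continuous hA hmp hC hNC x)
  have hI := (abs_le.1 (abs_interactionPotential_le hL hWp.laplacian hW.continuous_laplacian
    hC hNC hA' x)).1
  have hΔ := hx.laplacian_nonneg hN
  set θ := ((∫ x in torusCell d L, W x) * m - interactionPotential L W N x) / 2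
  set E := A * (m + m / κ) / 2
  set I := interactionPotential L (Laplacian.laplacian W) N x
  have he1 : Real.exp (-E) ≤ Real.exp θ := Real.exp_le_exp.2 hθ.1
  have he2 : Real.exp (-θ) ≤ Real.exp E := Real.exp_le_exp.2 (by linarith)
  have ha : 0 < √m := Real.sqrt_pos.2 hmp
  have hsq : √m * √m = m := Real.mul_self_sqrt hmp.le
  have hq : N x / √m = κ * √m := by
    rw [hNx, div_eq_iff ha.ne', mul_assoc, hsq]
  have hI' : -(A * m * m) ≤ N x * I := by
    rw [hNx]
    -- The factor `κ` from the lower bound cancels the `1 / κ` from the upper bound on `N`.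
    calc -(A * m * m) = κ * m * -(A * (m / κ)) := by field_simp
      _ ≤ κ * m * I := mul_le_mul_of_nonneg_left hI (by positivity)
  -- The domination inequality is the sign condition divided by `√m`; this restores the scale.
  have h1 := mul_lt_mul_of_pos_left hdom ha
  have h2 := mul_le_mul_of_nonneg_left he1 ha.le
  have h3 := mul_le_mul_of_nonneg_left he2 (mul_pos hκ₀ ha).le
  have h4 : √m * (A * m * √m) = A * m * m := by linear_combination A * m * hsq
  rw [hq]
  rw [mul_add, h4] at h1
  linarith

theorem grandCanonicalRHS_neg_of_max (hκ₀ : 0 < κ) (hL : 0 < L) (hWp : IsTorusPeriodic L W)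
    (hW : ContDiff ℝ 2 W) (hA : ∫ x in torusCell d L, |W x| ≤ A)
    (hA' : ∫ x in torusCell d L, |Laplacian.laplacian W x| ≤ A)
    (hm : IsUniformDensity L W μ m)
    (hdom : Real.exp (A * (m + m / κ) / 2) + A / κ * m * √m / κ <
        1 / κ * Real.exp (-(A * (m + m / κ) / 2)))
    (hN : ContDiff ℝ 2 N) (hNC : ∀ y, |N y| ≤ m / κ) {x : EuclideanSpace ℝ (Fin d)}
    (hx : IsLocalMax N x) (hNx : N x = 1 / κ * m) : grandCanonicalRHS L W μ N x < 0 := by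
  have hmp := hm.pos
  have hC : 0 ≤ m / κ := by positivity
  rw [grandCanonicalRHS_of_fderiv_eq_zero hL hW hm hN hx.fderiv_eq_zero]
  have hθ := abs_le.1 (abs_uniform_sub_potential_le hL hWp hW.continuous hA hmp hC hNC x)
  have hI := (abs_le.1 (abs_interactionPotential_le hL hWp.laplacian hW.continuous_laplacian
    hC hNC hA' x)).2
  have hΔ := hx.laplacian_nonpos hN
  set θ := ((∫ x in torusCell d L, W x) * m - interactionPotential L W N x) / 2
  set E := A * (m + m / κ) / 2
  set I := interactionPotential L (Laplacian.laplacian W) N x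
  have he1 : Real.exp θ ≤ Real.exp E := Real.exp_le_exp.2 hθ.2
  have he2 : Real.exp (-E) ≤ Real.exp (-θ) := Real.exp_le_exp.2 (by linarith)
  have ha : 0 < √m := Real.sqrt_pos.2 hmp
  have hsq : √m * √m = m := Real.mul_self_sqrt hmp.le
  have hq : N x / √m = 1 / κ * √m := by
    rw [hNx, div_eq_iff ha.ne', mul_assoc, hsq]
  have hI' : N x * I ≤ A / κ * m * m / κ := by
    rw [hNx]
    calc 1 / κ * m * I ≤ 1 / κ * m * (A * (m / κ)) :=
          mul_le_mul_of_nonneg_left hI (by positivity)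
      _ = A / κ * m * m / κ := by field_simp
  have h1 := mul_lt_mul_of_pos_left hdom ha
  have h2 := mul_le_mul_of_nonneg_left he1 ha.le
  have h3 := mul_le_mul_of_nonneg_left he2 (mul_pos (one_div_pos.2 hκ₀) ha).le
  have h4 : √m * (A / κ * m * √m / κ) = A / κ * m * m / κ := by
    linear_combination A / κ * m / κ * hsq
  rw [hq]
  rw [mul_add, h4] at h1
  linarith

end Estimates

/-! ### First touching time and conclusion -/

/-- If strict two-sided bounds for a periodic function of space and time are violated after the
initial time, then there is a first time at which one of them is attained. -/
theorem exists_first_touching {d : ℕ} {L : ℝ} (hL : 0 < L) {N : ℝ → EuclideanSpace ℝ (Fin d) → ℝ}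
    {t₀ t₁ a b : ℝ} (hp : ∀ t ∈ Set.Icc t₀ t₁, IsTorusPeriodic L (N t))
    (hc : ContinuousOn (fun p : ℝ × EuclideanSpace ℝ (Fin d) => N p.1 p.2)
      (Set.Icc t₀ t₁ ×ˢ Set.univ))
    (h0 : ∀ x, a < N t₀ x ∧ N t₀ x < b)
    (h1 : ∃ t ∈ Set.Icc t₀ t₁, ∃ x, ¬(a < N t x ∧ N t x < b)) :
    ∃ s ∈ Set.Ioc t₀ t₁, (∀ r ∈ Set.Ico t₀ s, ∀ x, a < N r x ∧ N r x < b) ∧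
      (∀ x, a ≤ N s x ∧ N s x ≤ b) ∧ ∃ x, N s x = a ∨ N s x = b := by
  obtain ⟨R, hR⟩ := exists_torusCell_subset_closedBall d hL
  set K : Set (ℝ × EuclideanSpace ℝ (Fin d)) := Set.Icc t₀ t₁ ×ˢ Metric.closedBall 0 R
  have hK : IsCompact K := isCompact_Icc.prod (isCompact_closedBall 0 R)
  have hcK : ContinuousOn (fun p : ℝ × EuclideanSpace ℝ (Fin d) => N p.1 p.2) K :=
    hc.mono (Set.prod_mono_right (Set.subset_univ _))
  set B := K ∩ (fun p : ℝ × EuclideanSpace ℝ (Fin d) => N p.1 p.2) ⁻¹' (Set.Ioo a b)ᶜ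
  have hB : IsCompact B :=
    hK.of_isClosed_subset (hcK.preimage_isClosed_of_isClosed hK.isClosed isOpen_Ioo.isClosed_compl)
      Set.inter_subset_left
  have hmem {t : ℝ} (ht : t ∈ Set.Icc t₀ t₁) {x} (hx : ¬(a < N t x ∧ N t x < b)) :
      t ∈ Prod.fst '' B := by
    obtain ⟨y, hy, hxy⟩ := exists_mem_torusCell hL x
    rw [hxy _ (hp t ht)] at hx
    exact ⟨(t, y), ⟨⟨ht, hR hy⟩, hx⟩, rfl⟩
  obtain ⟨t, ht, x, hx⟩ := h1
  -- The violation set `B` over the ball is compact, so its projection to time has a least element.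
  obtain ⟨s, ⟨⟨s', x'⟩, ⟨⟨hs, -⟩, hx'⟩, rfl⟩, hleast⟩ :=
    (hB.image continuous_fst).exists_isLeast ⟨t, hmem ht hx⟩
  dsimp only at hs hx' hleast ⊢
  have hlt : t₀ < s' := by
    refine lt_of_le_of_ne hs.1 ?_
    rintro rfl
    exact hx' (h0 x')
  have hbefore : ∀ r ∈ Set.Ico t₀ s', ∀ x, a < N r x ∧ N r x < b := by
    intro r hr x
    by_contra hcon
    exact absurd (hleast (hmem ⟨hr.1, hr.2.le.trans hs.2⟩ hcon)) (not_le.2 hr.2)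
  have hclosed : ∀ x, a ≤ N s' x ∧ N s' x ≤ b := by
    intro x
    have htend : Tendsto (fun r => N r x) (𝓝[Set.Ico t₀ s'] s') (𝓝 (N s' x)) := by
      have hcx : ContinuousOn (fun r => N r x) (Set.Icc t₀ t₁) :=
        hc.comp (f := fun r => (r, x)) (by fun_prop) fun r hr => ⟨hr, trivial⟩
      exact (hcx s' hs).mono fun r hr => ⟨hr.1, hr.2.le.trans hs.2⟩
    have : (𝓝[Set.Ico t₀ s'] s').NeBot := by
      rw [← mem_closure_iff_nhdsWithin_neBot, closure_Ico hlt.ne]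
      exact Set.right_mem_Icc.2 hlt.le
    have hev : ∀ᶠ r in 𝓝[Set.Ico t₀ s'] s', N r x ∈ Set.Icc a b := by
      filter_upwards [self_mem_nhdsWithin] with r hr
      exact ⟨(hbefore r hr x).1.le, (hbefore r hr x).2.le⟩
    exact isClosed_Icc.mem_of_tendsto htend hev
  refine ⟨s', ⟨hlt, hs.2⟩, hbefore, hclosed, x', ?_⟩
  by_contra! hne
  exact hx' ⟨lt_of_le_of_ne (hclosed x').1 hne.1.symm, lt_of_le_of_ne (hclosed x').2 hne.2⟩

theorem mainTheorem5 (κ : ℝ) (hκ₀ : 0 < κ) (hκ₁ : κ < 1 / 2) (A : ℝ) :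
    ∃ δ : ℝ, 0 < δ ∧
      ∀ (d : ℕ) (L : ℝ), 0 < L →
      ∀ W : EuclideanSpace ℝ (Fin d) → ℝ, IsTorusPeriodic L W → ContDiff ℝ 2 W →
        (∫ x in torusCell d L, |W x|) ≤ A →
        (∫ x in torusCell d L, |Laplacian.laplacian W x|) ≤ A →
      ∀ μ m₀ : ℝ, IsUniformDensity L W μ m₀ → m₀ < δ →
      ∀ (T : EReal) (N : ℝ → EuclideanSpace ℝ (Fin d) → ℝ),
        IsGrandCanonicalSolution L W μ T N →
      ∀ t₀ : ℝ, 0 ≤ t₀ → (t₀ : EReal) < T →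
        (∀ x, κ * m₀ < N t₀ x ∧ N t₀ x < 1 / κ * m₀) →
      ∀ t : ℝ, t₀ < t → (t : EReal) < T →
        ∀ x, κ * m₀ < N t x ∧ N t x < 1 / κ * m₀ := by
  obtain ⟨δ, hδ, hdom⟩ := exists_reaction_dominates hκ₀ (hκ₁.trans (by norm_num)) A
  refine ⟨δ, hδ, ?_⟩
  intro d L hL W hWp hW hA hA' μ m₀ hm hmδ T N hN t₀ ht₀ _ h0 t ht htT x
  have hmp := hm.pos
  obtain ⟨hdom1, hdom2⟩ := hdom m₀ hmp hmδ
  by_contra hcon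
  have hle {s : ℝ} (hs : s ≤ t) : (s : EReal) < T :=
    lt_of_le_of_lt (EReal.coe_le_coe_iff.2 hs) htT
  obtain ⟨s, hs, hbefore, hclosed, y, hy⟩ := exists_first_touching hL
    (fun r hr => hN.periodic r (ht₀.trans hr.1) (hle hr.2))
    (hN.continuousOn.mono (Set.prod_mono_left fun r hr => ⟨ht₀.trans hr.1, hle hr.2⟩)) h0
    ⟨t, ⟨ht.le, le_rfl⟩, x, hcon⟩
  -- Touching occurs strictly after `t₀`, so the equation holds at `s` even when `t₀ = 0`.
  have hspos : 0 < s := lt_of_le_of_lt ht₀ hs.1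
  have hsC := hN.contDiff s hspos (hle hs.2)
  have hderiv := hN.equation s hspos (hle hs.2) y
  have hNC : ∀ z, |N s z| ≤ m₀ / κ := fun z => by
    have hz := hclosed z
    have : 0 ≤ N s z := (mul_pos hκ₀ hmp).le.trans hz.1
    rw [abs_of_nonneg this, div_eq_inv_mul, ← one_div]
    exact hz.2
  rcases hy with hy | hy
  · have hmin : IsLocalMin (N s) y := Eventually.of_forall fun z => hy.trans_le (hclosed z).1
    obtain ⟨r, hr, hlt⟩ := exists_lt_of_hasDerivAt_pos hs.1 hderiv
      (grandCanonicalRHS_pos_of_min hκ₀ hL hWp hW hA hA' hm hdom1 hsC hNC hmin hy)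
    have := (hbefore r ⟨hr.1.le, hr.2⟩ y).1
    linarith
  · have hmax : IsLocalMax (N s) y := Eventually.of_forall fun z => (hclosed z).2.trans_eq hy.symm
    obtain ⟨r, hr, hlt⟩ := exists_lt_of_hasDerivAt_pos hs.1 hderiv.neg
      (neg_pos.2 (grandCanonicalRHS_neg_of_max hκ₀ hL hWp hW hA hA' hm hdom2 hsC hNC hmax hy))
    have := (hbefore r ⟨hr.1.le, hr.2⟩ y).2
    simp only [Pi.neg_apply] at hlt
    linarith
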